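/- Let $A$ be a finite alphabet and let $\alpha$ be an infinite word over $A$. Call $\alpha$ ultimately periodic if $\alpha = x\,y\,y\,y\cdots$ for finite words $x, y$ over $A$ with $y$ nonempty. Say that $\alpha$ is morphic with growth $f(n)$ if there are a finite alphabet $B$, a monoid morphism $h : B^* \to B^*$, a letter $c \in B$ and a letter-to-letter map (coding) $\tau : B \to A$ such that $h(c) = cx$ for some $x \in B^*$ with $h^m(x)$ nonempty for every $m \ge 0$, $\alpha = \tau\bigl(c\,x\,h(x)\,h^2(x)\cdots\bigr)$, and $|h^n(c)| = f(n)$ for all $n \ge 0$. Then $\alpha$ is morphic with growth $f(n)$ for some $f$ with $f(n) = O(n)$ as $n \to \infty$ if and only if $\alpha$ is ultimately periodic. -/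

import Mathlib

/-! Strings over an alphabet `B` are the elements of the free monoid `FreeMonoid B`, a morphism on
`B` is a monoid endomorphism of `FreeMonoid B`, and infinite words over `A` are elements of
`Stream' A` (letters are indexed from `0`). -/

namespace MorphicWord

/-- A string `x` is mortal for the morphism `h` if `h ^ m (x)` is empty for some `m ≥ 0`. -/
def Mortal {B : Type*} (h : FreeMonoid B →* FreeMonoid B) (x : FreeMonoid B) : Prop :=
  ∃ m : ℕ, h^[m] x = 1

/-- The morphism `h` is prolongable on the letter `c` if `h (c) = c x` for a string `x` that is
not mortal. -/
def Prolongable {B : Type*} (h : FreeMonoid B →* FreeMonoid B) (c : B) : Prop :=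
  ∃ x : FreeMonoid B, h (FreeMonoid.of c) = FreeMonoid.of c * x ∧ ¬ Mortal h x

/-- The infinite word `β` is the infinite concatenation `u 0, u 1, u 2, …` of strings: every finite
concatenation `u 0 ⋯ u (n - 1)` is a prefix of `β`, and these prefixes are arbitrarily long (so that
`β` is determined by `u`). -/
def IsInfiniteConcat {B : Type*} (u : ℕ → FreeMonoid B) (β : Stream' B) : Prop :=
  (∀ n : ℕ, ((List.range n).map u).prod.toList =
      β.take ((List.range n).map u).prod.length) ∧
    ∀ N : ℕ, ∃ n : ℕ, N ≤ ((List.range n).map u).prod.length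

/-- The sequence of strings `c, x, h (x), h ^ 2 (x), …`. -/
def blocks {B : Type*} (h : FreeMonoid B →* FreeMonoid B) (c : B) (x : FreeMonoid B) :
    ℕ → FreeMonoid B
  | 0 => FreeMonoid.of c
  | n + 1 => h^[n] x

/-- `β` is the infinite word `h ^ ω (c) = c x h(x) h ^ 2 (x) ⋯`, where `h (c) = c x`
(to be used for `h` prolongable on `c`). -/
def IsOmegaIterate {B : Type*} (h : FreeMonoid B →* FreeMonoid B) (c : B) (β : Stream' B) : Prop :=
  ∃ x : FreeMonoid B, h (FreeMonoid.of c) = FreeMonoid.of c * x ∧ IsInfiniteConcat (blocks h c x) β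

/-- `(h, c, τ)` is a representation of `α` as a morphic word: `h` is prolongable on `c` and
`α = τ (h ^ ω (c))`. The coding is given by its values `τ : B → A` on letters. -/
def IsRepresentation {A B : Type*} (h : FreeMonoid B →* FreeMonoid B) (c : B) (τ : B → A)
    (α : Stream' A) : Prop :=
  Prolongable h c ∧ ∃ β : Stream' B, IsOmegaIterate h c β ∧ α = β.map τ

/-- The infinite word `α` is morphic with growth `f`: it has a representation `(h, c, τ)` over some
finite alphabet `B` with `|h ^ n (c)| = f n` for all `n ≥ 0`. -/
def IsMorphicWithGrowth {A : Type*} (α : Stream' A) (f : ℕ → ℕ) : Prop :=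
  ∃ (B : Type) (_ : Finite B) (h : FreeMonoid B →* FreeMonoid B) (c : B) (τ : B → A),
    IsRepresentation h c τ α ∧ ∀ n : ℕ, (h^[n] (FreeMonoid.of c)).length = f n

/-- The infinite word `α` is ultimately periodic: it has the form `x y y y ⋯` for strings `x`, `y`
with `y` nonempty. -/
def UltimatelyPeriodic {A : Type*} (α : Stream' A) : Prop :=
  ∃ (x y : List A) (hy : y ≠ []), α = x ++ₛ Stream'.cycle y hy

end MorphicWord

/-! If `h c = c x`, then `h ^ n (c) = c x h(x) ⋯ h ^ (n - 1) (x)`. When the length of this string is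
`O(n)`, the strings `h ^ i (x)` cannot all be different: there are only finitely many strings of
bounded length over a finite alphabet, so the lengths of pairwise different strings `h ^ i (x)` would
tend to infinity and `|h ^ n (c)|` would outgrow every linear function. Hence `h ^ i (x) = h ^ j (x)`
for some `i < j` (`exists_iterate_eq_of_length_isBigO`), and then the sequence `x, h(x), h ^ 2 (x),
…` is itself ultimately periodic, with nonempty period `h ^ i (x) ⋯ h ^ (j - 1) (x)` as `x` is not
mortal (`IsInfiniteConcat.ultimatelyPeriodic`).

Conversely, let `α (i + q) = α i` for all `i > p`. Use the numbers below `p + 1 + q` as letters, and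
let the morphism map `0` to `0 1 2 ⋯ (p + q)`, erase the letters `1, …, p`, and fix the letters from
`p + 1` on. It generates `0 1 ⋯ p` followed by the repetition of `(p + 1) ⋯ (p + q)`, its `n`-th
iterate on `0` has length `1 + p + n q` for `n ≥ 1`, and `α` is the image of the generated word under
`i ↦ α i` (`isOmegaIterate_lassoHom`, `length_lassoHom_iterate_le`, `eq_map_lasso`). -/

namespace MorphicWord

/-! ### Ultimate periodicity in terms of letters -/

theorem ultimatelyPeriodic_iff {A : Type*} {α : Stream' A} :
    UltimatelyPeriodic α ↔ ∃ p q : ℕ, 0 < q ∧ ∀ i, p ≤ i → α.get (i + q) = α.get i := by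
  constructor
  · rintro ⟨x, y, hy, rfl⟩
    refine ⟨x.length, y.length, List.length_pos_iff.2 hy, fun i hi => ?_⟩
    obtain ⟨k, rfl⟩ := Nat.exists_eq_add_of_le hi
    have h1 := congrArg (Stream'.get · k) (Stream'.cycle_eq y hy)
    rw [Nat.add_assoc, Stream'.get_append_right, Stream'.get_append_right, Nat.add_comm k]
    conv_lhs => rw [Stream'.cycle_eq y hy]
    rw [Stream'.get_append_right]
  · rintro ⟨p, q, hq, hα⟩
    have hy : (α.drop p).take q ≠ [] := by
      rw [← List.length_pos_iff, Stream'.length_take]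
      exact hq
    refine ⟨α.take p, (α.drop p).take q, hy, ?_⟩
    have hdrop : (α.drop p).drop q = α.drop p := by
      ext i
      simp only [Stream'.get_drop]
      rw [← hα (p + i) (Nat.le_add_right p i)]
      congr 1
      omega
    have hcycle : α.drop p = Stream'.cycle ((α.drop p).take q) hy := by
      -- Both sides are fixed by prepending the period, so their first `k * q` letters agree.
      have hk : ∀ k i, i < k * q →
          (α.drop p).get i = (Stream'.cycle ((α.drop p).take q) hy).get i := by
        intro k
        induction k with
        | zero => intro i hi; omega
        | succ k ih =>
          intro i hi
          rw [Nat.succ_mul] at hi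
          have e := Stream'.append_take_drop q (α.drop p)
          rw [hdrop] at e
          rw [Stream'.cycle_eq]
          conv_lhs => rw [← e]
          by_cases hiq : i < q
          · rw [Stream'.get_append_left _ _ _ (by simpa using hiq),
              Stream'.get_append_left _ _ _ (by simpa using hiq)]
          · obtain ⟨j, rfl⟩ := Nat.exists_eq_add_of_le (not_lt.1 hiq)
            have hl : q + j = ((α.drop p).take q).length + j := by simp
            rw [hl, Stream'.get_append_right, Stream'.get_append_right]
            exact ih j (by omega)
      ext i
      exact hk (i + 1) i (by nlinarith)
    rw [← hcycle, Stream'.append_take_drop]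

/-! ### Products of blocks -/

theorem prod_map_range_succ {M : Type*} [Monoid M] (u : ℕ → M) (n : ℕ) :
    ((List.range (n + 1)).map u).prod = ((List.range n).map u).prod * u n := by
  simp [List.range_succ]

theorem prod_map_range_add {M : Type*} [Monoid M] (u : ℕ → M) (m n : ℕ) :
    ((List.range (m + n)).map u).prod =
      ((List.range m).map u).prod * ((List.range n).map fun i => u (m + i)).prod := by
  rw [List.range_add, List.map_append, List.prod_append, List.map_map]
  rfl

theorem iterate_of_eq_prod_blocks {B : Type*} {h : FreeMonoid B →* FreeMonoid B} {c : B}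
    {x : FreeMonoid B} (hc : h (FreeMonoid.of c) = FreeMonoid.of c * x) (n : ℕ) :
    h^[n] (FreeMonoid.of c) = ((List.range (n + 1)).map (blocks h c x)).prod := by
  induction n with
  | zero => simp [blocks]
  | succ n ih =>
    rw [Function.iterate_succ_apply, hc, iterate_map_mul, ih, prod_map_range_succ _ (n + 1)]
    rfl

/-! ### Linear growth forces ultimate periodicity -/

/-- Were `x, h x, h^[2] x, …` pairwise different, their lengths would tend to infinity, because there
are only finitely many strings of bounded length. -/
theorem exists_iterate_eq_of_length_isBigO {B : Type*} [Finite B]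
    {h : FreeMonoid B →* FreeMonoid B} {c : B} {x : FreeMonoid B}
    (hc : h (FreeMonoid.of c) = FreeMonoid.of c * x)
    (hO : (fun n : ℕ => ((h^[n] (FreeMonoid.of c)).length : ℝ)) =O[Filter.atTop]
      (fun n : ℕ => (n : ℝ))) :
    ∃ i d : ℕ, 0 < d ∧ h^[i + d] x = h^[i] x := by
  by_contra! hne
  have hinj : Function.Injective fun n : ℕ => h^[n] x := by
    intro i j hij
    by_contra hne'
    rcases lt_or_gt_of_ne hne' with hlt | hlt
    · obtain ⟨d, rfl⟩ := Nat.exists_eq_add_of_le hlt.le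
      exact hne i d (by omega) hij.symm
    · obtain ⟨d, rfl⟩ := Nat.exists_eq_add_of_le hlt.le
      exact hne j d (by omega) hij
  obtain ⟨C, hC⟩ := hO.bound
  obtain ⟨K, hK⟩ := exists_nat_gt C
  have hfin : {n : ℕ | (h^[n] x).length ≤ K}.Finite :=
    (List.finite_length_le B K).preimage hinj.injOn
  obtain ⟨M, hM⟩ := hfin.bddAbove
  have hlong : ∀ i, K + 1 ≤ (h^[M + 1 + i] x).length := by
    intro i
    by_contra hlt
    have : M + 1 + i ≤ M := hM (show (h^[M + 1 + i] x).length ≤ K by omega)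
    omega
  have hgrow : ∀ n, (K + 1) * n ≤ (h^[M + 1 + n] (FreeMonoid.of c)).length := by
    intro n
    induction n with
    | zero => simp
    | succ n ih =>
      rw [← Nat.add_assoc, Function.iterate_succ_apply, hc, iterate_map_mul, FreeMonoid.length_mul]
      have := hlong n
      nlinarith
  obtain ⟨N, hN⟩ := Filter.eventually_atTop.1 hC
  -- For large `n` the bounds `(K + 1) * n ≤ |h^[M + 1 + n] c| ≤ K * (M + 1 + n)` conflict.
  set n := N + K * (M + 1) + 1 with hn
  have h1 := hN (M + 1 + n) (by rw [hn]; nlinarith [Nat.zero_le (K * (M + 1))])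
  rw [Real.norm_natCast, Real.norm_natCast] at h1
  have h2 : ((h^[M + 1 + n] (FreeMonoid.of c)).length : ℝ) ≤ K * ((M + 1 + n : ℕ) : ℝ) :=
    h1.trans (mul_le_mul_of_nonneg_right hK.le (Nat.cast_nonneg _))
  have h3 : (h^[M + 1 + n] (FreeMonoid.of c)).length ≤ K * (M + 1 + n) := by exact_mod_cast h2
  have h4 := hgrow n
  nlinarith [Nat.zero_le N]

/-- If the blocks `u k` repeat with period `d` from `k = s` on, the word repeats with period
`|u s ⋯ u (s + d - 1)|` from position `|u 0 ⋯ u (s - 1)|` on. -/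
theorem IsInfiniteConcat.ultimatelyPeriodic {B : Type*} {u : ℕ → FreeMonoid B} {β : Stream' B}
    (hβ : IsInfiniteConcat u β) {s d : ℕ} (hu : ∀ k, s ≤ k → u (k + d) = u k)
    (hd : 0 < ((List.range d).map fun i => u (s + i)).prod.length) :
    UltimatelyPeriodic β := by
  obtain ⟨hpre, hlen⟩ := hβ
  set P := ((List.range s).map u).prod with hP
  set Y := ((List.range d).map fun i => u (s + i)).prod with hY
  refine ultimatelyPeriodic_iff.2 ⟨P.length, Y.length, hd, fun i hi => ?_⟩
  obtain ⟨t, rfl⟩ := Nat.exists_eq_add_of_le hi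
  obtain ⟨m, hm⟩ := hlen (P.length + t + 1)
  set W := ((List.range m).map fun i => u (s + i)).prod with hW
  have h1 : ((List.range (s + m)).map u).prod = P * W := prod_map_range_add u s m
  have h2 : ((List.range (s + d + m)).map u).prod = P * Y * W := by
    rw [prod_map_range_add u (s + d) m, prod_map_range_add u s d, ← hP, ← hY, hW]
    congr 3
    ext1 i
    rw [← hu (s + i) (Nat.le_add_right s i)]
    congr 1
    omega
  have hWt : t < W.length := by
    have h3 : ((List.range (m + s)).map u).prod = P * W := by rw [Nat.add_comm, h1]
    rw [prod_map_range_add u m s] at h3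
    have := congrArg FreeMonoid.length h3
    simp only [FreeMonoid.length_mul] at this
    omega
  have e1 := hpre (s + m)
  have e2 := hpre (s + d + m)
  rw [h1] at e1
  rw [h2] at e2
  have g1 := congrArg (fun l : List B => l[P.length + t]?) e1
  have g2 := congrArg (fun l : List B => l[P.length + Y.length + t]?) e2
  have hPl : P.toList.length = P.length := rfl
  have hYl : Y.toList.length = Y.length := rfl
  have g3 : (P * W).toList[P.length + t]? = W.toList[t]? := by
    rw [FreeMonoid.toList_mul, List.getElem?_append_right (by omega), hPl, Nat.add_sub_cancel_left]
  have g4 : (P * Y * W).toList[P.length + Y.length + t]? = W.toList[t]? := by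
    rw [FreeMonoid.toList_mul, FreeMonoid.toList_mul,
      List.getElem?_append_right (by rw [List.length_append]; omega), List.length_append, hPl, hYl,
      Nat.add_sub_cancel_left]
  simp only [g3, g4] at g1 g2
  rw [Stream'.getElem?_take (by simp only [FreeMonoid.length_mul]; omega)] at g1
  rw [Stream'.getElem?_take (by simp only [FreeMonoid.length_mul]; omega)] at g2
  have := Option.some_injective _ (g2.symm.trans g1)
  rwa [Nat.add_right_comm] at this

theorem IsOmegaIterate.ultimatelyPeriodic {B : Type*} [Finite B]
    {h : FreeMonoid B →* FreeMonoid B} {c : B} {β : Stream' B} (hp : Prolongable h c)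
    (hβ : IsOmegaIterate h c β)
    (hO : (fun n : ℕ => ((h^[n] (FreeMonoid.of c)).length : ℝ)) =O[Filter.atTop]
      (fun n : ℕ => (n : ℝ))) :
    UltimatelyPeriodic β := by
  obtain ⟨x, hx, hcat⟩ := hβ
  obtain ⟨x', hx', hmortal⟩ := hp
  obtain rfl : x = x' := mul_left_cancel (hx.symm.trans hx')
  obtain ⟨i, d, hd, hid⟩ := exists_iterate_eq_of_length_isBigO hx hO
  refine hcat.ultimatelyPeriodic (s := i + 1) (d := d) (fun k hk => ?_) ?_
  · obtain ⟨j, rfl⟩ := Nat.exists_eq_add_of_le hk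
    have e1 : i + 1 + j + d = (j + (i + d)) + 1 := by omega
    have e2 : i + 1 + j = (j + i) + 1 := by omega
    rw [e1, e2]
    simp only [blocks]
    rw [Function.iterate_add_apply, hid, ← Function.iterate_add_apply]
  · obtain ⟨d, rfl⟩ := Nat.exists_eq_succ_of_ne_zero hd.ne'
    rw [Nat.succ_eq_add_one, prod_map_range_succ, FreeMonoid.length_mul]
    have hne : (blocks h c x (i + 1 + d)).length ≠ 0 := by
      rw [Nat.add_right_comm, Ne, FreeMonoid.length_eq_zero]
      exact fun h0 => hmortal ⟨i + d, h0⟩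
    omega

theorem UltimatelyPeriodic.map {A B : Type*} {β : Stream' B} (hβ : UltimatelyPeriodic β)
    (τ : B → A) : UltimatelyPeriodic (β.map τ) := by
  obtain ⟨p, q, hq, h⟩ := ultimatelyPeriodic_iff.1 hβ
  refine ultimatelyPeriodic_iff.2 ⟨p, q, hq, fun i hi => ?_⟩
  rw [Stream'.get_map, Stream'.get_map, h i hi]

/-! ### Ultimately periodic words have linear growth -/

/-- Blocks cut out of `β` at the positions `0 = ℓ 0 < ℓ 1 < ℓ 2 < ⋯` concatenate to `β`. -/
theorem isInfiniteConcat_of_forall_eq_take {B : Type*} {u : ℕ → FreeMonoid B} {β : Stream' B}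
    (ℓ : ℕ → ℕ) (h0 : ℓ 0 = 0) (hmono : StrictMono ℓ)
    (hu : ∀ n, (u n).toList = (β.drop (ℓ n)).take (ℓ (n + 1) - ℓ n)) : IsInfiniteConcat u β := by
  have key : ∀ n, ((List.range n).map u).prod.toList = β.take (ℓ n) := by
    intro n
    induction n with
    | zero => simp [h0]
    | succ n ih =>
      rw [prod_map_range_succ, FreeMonoid.toList_mul, ih, hu, ← Stream'.take_add,
        Nat.add_sub_cancel' (hmono n.lt_succ_self).le]
  have hlen : ∀ n, ((List.range n).map u).prod.length = ℓ n := by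
    intro n
    have := congrArg List.length (key n)
    rwa [Stream'.length_take] at this
  refine ⟨fun n => by rw [hlen, key], fun N => ⟨N, ?_⟩⟩
  rw [hlen]
  exact hmono.le_apply

/-- The word `0 1 2 ⋯ p` followed by the repetition of `(p + 1) ⋯ (p + q)`. -/
def lasso (p q : ℕ) [NeZero q] : Stream' (Fin (p + 1 + q)) := fun i =>
  if hi : i ≤ p then ⟨i, by omega⟩
  else ⟨p + 1 + (i - (p + 1)) % q, Nat.add_lt_add_left (Nat.mod_lt _ (NeZero.pos q)) _⟩

/-- The morphism that maps `0` to `0 1 2 ⋯ (p + q)`, erases `1, …, p` and fixes the other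
letters. -/
def lassoHom (p q : ℕ) [NeZero q] : FreeMonoid (Fin (p + 1 + q)) →* FreeMonoid (Fin (p + 1 + q)) :=
  FreeMonoid.lift fun b =>
    if b.1 = 0 then FreeMonoid.ofList ((lasso p q).take (p + 1 + q))
    else if b.1 ≤ p then 1 else FreeMonoid.of b

variable (p q : ℕ) [NeZero q]

theorem lasso_get_of_le {i : ℕ} (hi : i ≤ p) : ((lasso p q).get i).1 = i := by
  simp [lasso, Stream'.get, hi]

theorem lasso_get_add (i : ℕ) : ((lasso p q).get (p + 1 + i)).1 = p + 1 + i % q := by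
  have : ¬ p + 1 + i ≤ p := by omega
  simp [lasso, Stream'.get, this]

theorem lasso_drop_add_mul (n : ℕ) :
    (lasso p q).drop (p + 1 + n * q) = (lasso p q).drop (p + 1) := by
  ext i
  rw [Stream'.get_drop, Stream'.get_drop, Nat.add_assoc (p + 1), lasso_get_add, lasso_get_add,
    Nat.mul_add_mod_self_right]

/-- The tail of `h 0`, for `h = lassoHom p q`: the string `1 2 ⋯ (p + q)`. -/
def lassoTail : FreeMonoid (Fin (p + 1 + q)) :=
  FreeMonoid.ofList (((lasso p q).drop 1).take (p + q))

/-- The period `(p + 1) ⋯ (p + q)`. -/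
def lassoPeriod : FreeMonoid (Fin (p + 1 + q)) :=
  FreeMonoid.ofList (((lasso p q).drop (p + 1)).take q)

theorem freeMonoid_map_ofList_eq_one {B M : Type*} [Monoid M] (h : FreeMonoid B →* M) (l : List B)
    (hl : ∀ b ∈ l, h (FreeMonoid.of b) = 1) : h (FreeMonoid.ofList l) = 1 := by
  induction l with
  | nil => exact map_one h
  | cons b l ih =>
    rw [FreeMonoid.ofList_cons, map_mul, hl b (by simp), ih fun a ha => hl a (by simp [ha]), one_mul]

theorem freeMonoid_map_ofList_eq_self {B : Type*} (h : FreeMonoid B →* FreeMonoid B) (l : List B)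
    (hl : ∀ b ∈ l, h (FreeMonoid.of b) = FreeMonoid.of b) :
    h (FreeMonoid.ofList l) = FreeMonoid.ofList l := by
  induction l with
  | nil => exact map_one h
  | cons b l ih =>
    rw [FreeMonoid.ofList_cons, map_mul, hl b (by simp), ih fun a ha => hl a (by simp [ha])]

theorem lassoHom_zero : lassoHom p q (FreeMonoid.of ((lasso p q).get 0)) =
    FreeMonoid.of ((lasso p q).get 0) * lassoTail p q := by
  have h0 := lasso_get_of_le p q (Nat.zero_le p)
  rw [lassoHom, FreeMonoid.lift_eval_of, if_pos h0, lassoTail, ← FreeMonoid.ofList_cons]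
  congr 1
  exact (congrArg (fun k => (lasso p q).take k) (Nat.add_right_comm p 1 q)).trans
    (Stream'.take_succ (p + q) _)

theorem lassoHom_period : lassoHom p q (lassoPeriod p q) = lassoPeriod p q := by
  refine freeMonoid_map_ofList_eq_self _ _ fun b hb => ?_
  obtain ⟨i, hi, rfl⟩ := List.getElem_of_mem hb
  rw [Stream'.take_get, Stream'.get_drop]
  have := lasso_get_add p q i
  rw [lassoHom, FreeMonoid.lift_eval_of, if_neg (by omega), if_neg (by omega)]

theorem lassoHom_tail : lassoHom p q (lassoTail p q) = lassoPeriod p q := by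
  have hsplit : lassoTail p q =
      FreeMonoid.ofList (((lasso p q).drop 1).take p) * lassoPeriod p q := by
    rw [lassoTail, lassoPeriod, Stream'.take_add, FreeMonoid.ofList_append, Stream'.drop_drop,
      Nat.add_comm 1 p]
  rw [hsplit, map_mul, lassoHom_period, freeMonoid_map_ofList_eq_one, one_mul]
  intro b hb
  obtain ⟨i, hi, rfl⟩ := List.getElem_of_mem hb
  rw [Stream'.length_take] at hi
  rw [Stream'.take_get, Stream'.get_drop]
  have := lasso_get_of_le p q (show 1 + i ≤ p by omega)
  rw [lassoHom, FreeMonoid.lift_eval_of, if_neg (by omega), if_pos (by omega)]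

theorem lassoHom_iterate_tail (n : ℕ) : (lassoHom p q)^[n + 1] (lassoTail p q) = lassoPeriod p q := by
  rw [Function.iterate_succ_apply, lassoHom_tail]
  exact Function.iterate_fixed (lassoHom_period p q) n

theorem length_lassoPeriod : (lassoPeriod p q).length = q :=
  Stream'.length_take ..

theorem prolongable_lassoHom : Prolongable (lassoHom p q) ((lasso p q).get 0) := by
  refine ⟨lassoTail p q, lassoHom_zero p q, ?_⟩
  rintro ⟨m, hm⟩
  have h1 := congrArg FreeMonoid.length (lassoHom_iterate_tail p q m)
  rw [Function.iterate_succ_apply', hm, map_one, length_lassoPeriod] at h1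
  exact NeZero.ne q h1.symm

theorem isOmegaIterate_lassoHom : IsOmegaIterate (lassoHom p q) ((lasso p q).get 0) (lasso p q) := by
  refine ⟨lassoTail p q, lassoHom_zero p q, isInfiniteConcat_of_forall_eq_take
    (fun | 0 => 0 | 1 => 1 | n + 2 => p + 1 + (n + 1) * q) rfl (strictMono_nat_of_lt_succ ?_) ?_⟩
  · have := NeZero.pos q
    rintro (_ | _ | n)
    · simp
    · simp; omega
    · simp only [Nat.add_mul]; omega
  · rintro (_ | _ | n)
    · rfl
    · simp only [blocks, Function.iterate_zero, id, lassoTail, FreeMonoid.toList_ofList]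
      congr 1
      omega
    · simp only [blocks]
      rw [lassoHom_iterate_tail, lassoPeriod, FreeMonoid.toList_ofList, lasso_drop_add_mul]
      congr 1
      simp only [Nat.add_mul]
      omega

theorem length_lassoHom_iterate_le (n : ℕ) :
    ((lassoHom p q)^[n] (FreeMonoid.of ((lasso p q).get 0))).length ≤ (p + q) * n + 1 := by
  induction n with
  | zero => simp
  | succ n ih =>
    rw [Function.iterate_succ_apply, lassoHom_zero, iterate_map_mul, FreeMonoid.length_mul]
    have : ((lassoHom p q)^[n] (lassoTail p q)).length ≤ p + q := by
      cases n with
      | zero => exact (Stream'.length_take ..).le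
      | succ n => rw [lassoHom_iterate_tail, length_lassoPeriod]; omega
    rw [Nat.mul_succ]
    omega

variable {p q} in
theorem eq_map_lasso {A : Type*} {α : Stream' A} (hα : ∀ i, p + 1 ≤ i → α.get (i + q) = α.get i) :
    α = (lasso p q).map fun b => α.get b.1 := by
  ext i
  rw [Stream'.get_map]
  by_cases hi : i ≤ p
  · rw [lasso_get_of_le p q hi]
  · obtain ⟨j, rfl⟩ := Nat.exists_eq_add_of_le (Nat.lt_of_not_le hi)
    have hper : Function.Periodic (fun j => α.get (p + 1 + j)) q := fun j =>
      (congrArg α.get (Nat.add_assoc (p + 1) j q)).symm.trans (hα _ (Nat.le_add_right ..))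
    exact (hper.map_mod_nat j).symm.trans (congrArg α.get (lasso_get_add p q j).symm)

end MorphicWord

theorem theorem4 {A : Type*} [Finite A] (α : Stream' A) :
    (∃ f : ℕ → ℕ, MorphicWord.IsMorphicWithGrowth α f ∧
        (fun n : ℕ => (f n : ℝ)) =O[Filter.atTop] (fun n : ℕ => (n : ℝ))) ↔
      MorphicWord.UltimatelyPeriodic α := by
  constructor
  · rintro ⟨f, ⟨B, _, h, c, τ, ⟨hp, β, hβ, rfl⟩, hf⟩, hO⟩
    obtain rfl : (fun n => (h^[n] (FreeMonoid.of c)).length) = f := funext hf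
    exact (hβ.ultimatelyPeriodic hp hO).map τ
  · intro hα
    obtain ⟨p, q, hq, hper⟩ := MorphicWord.ultimatelyPeriodic_iff.1 hα
    have : NeZero q := ⟨hq.ne'⟩
    refine ⟨_, ⟨Fin (p + 1 + q), inferInstance, MorphicWord.lassoHom p q,
      (MorphicWord.lasso p q).get 0, fun b => α.get b.1,
      ⟨MorphicWord.prolongable_lassoHom p q, _, MorphicWord.isOmegaIterate_lassoHom p q,
        MorphicWord.eq_map_lasso fun i hi => hper i (by omega)⟩, fun _ => rfl⟩, ?_⟩
    refine Asymptotics.IsBigO.of_bound ((p + q + 1 : ℕ) : ℝ) ?_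
    filter_upwards [Filter.eventually_ge_atTop 1] with n hn
    rw [Real.norm_natCast, Real.norm_natCast]
    have := MorphicWord.length_lassoHom_iterate_le p q n
    exact_mod_cast this.trans (by rw [Nat.add_mul (p + q)]; omega)
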